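/- Let $0<P<1$ and $0<\delta\le 1$. For $n'\in\mathbb N$ put $t=\lfloor \log^{1-\delta} n'\rfloor$ and $n=\lfloor n'/t\rfloor\, t$, and consider the Min-Knapsack linear program $$(LP)\qquad \min\Big\{\sum_{j=1}^n x_j \;:\; \sum_{j=1}^n x_j\ge P,\ x\in[0,1]^n\Big\}.$$ For constraints $g_\ell(x)\ge 0$, $\ell\in[m]$, with $g_\ell$ affine linear, let $x_I\in\{0,1\}^n$ be the indicator vector of $I\subseteq N=\{1,\dots,n\}$, and let $Z_I$ be the $0/1$ vector indexed by the subsets $J\subseteq N$ with $|J|\le q$ whose $J$-th entry is $1$ if and only if $J\subseteq I$. The $t$-th round SoS (Lasserre) relaxation $\mathrm{SoS}_t$ is the set of all $(y_I)_{I\subseteq N}\in\mathbb R^{2^N}$ with $\sum_I y_I=1$, $\sum_I y_I Z_IZ_I^\top\succeq 0$ for $q=t+d$ (where $d=0$ if $m=0$, and $d=1$ otherwise), and $\sum_I g_\ell(x_I)y_I Z_IZ_I^\top\succeq 0$ for $q=t$ and all $\ell\in[m]$. The value of $y$ is $\sum_I |I|\,y_I$. There are $\varepsilon=\varepsilon(n')>0$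 with $\varepsilon=o(t^{-1})$ as $n'\to\infty$ such that, for all sufficiently large $n'$, the symmetric vector $$y_I=\binom{n}{|I|}^{-1}\cdot\begin{cases}\dfrac{(1+\varepsilon)P}{\lfloor\log n\rfloor} & |I|=\lfloor \log n\rfloor,\\[2mm] \dfrac{\varepsilon t}{jn} & |I|=j\frac nt,\ j\in\{1,\dots,t\},\\[1mm] 1-\sum_{\emptyset\ne J\subseteq N}y_J & I=\emptyset,\\ 0&\text{otherwise}\end{cases}$$ is feasible for $\mathrm{SoS}_t(LP)$. Its integrality gap is arbitrarily close to $P$: as $n'\to\infty$, the ratio of its value to the optimal integral value of $(LP)$ tends to $P$, and so does the ratio of the optimal value of $\mathrm{SoS}_t(LP)$ to the optimal integral value. In particular, for all sufficiently large $n'$ the Lasserre rank of $(LP)$ (the least $s$ such that the projection $\{(\sum_{I\ni i}y_I)_{i\in N} : y\in\mathrm{SoS}_s(LP)\}$ equals the convex hull of the $0/1$ points satisfying the constraints) is greater than $t$. -/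

import Mathlib

open Filter Topology Asymptotics

noncomputable section

/-- A linear constraint `∑ i, coeff i * x i - rhs ≥ 0` on `ℝⁿ`. -/
structure LinConstraint (n : ℕ) where
  coeff : Fin n → ℝ
  rhs : ℝ

/-- The value `g(x)` of the constraint at `x`. -/
def LinConstraint.eval {n : ℕ} (g : LinConstraint n) (x : Fin n → ℝ) : ℝ :=
  ∑ i, g.coeff i * x i - g.rhs

/-- The 0/1 point `x_I`. -/
def zeroOnePoint {n : ℕ} (I : Finset (Fin n)) : Fin n → ℝ :=
  fun i => if i ∈ I then 1 else 0

/-- The subsets of `{1, …, n}` of size at most `q`. -/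
abbrev SmallSubset (n q : ℕ) : Type := {J : Finset (Fin n) // J.card ≤ q}

/-- The `q`-zeta vector `Z_I`. -/
def zetaVec {n : ℕ} (q : ℕ) (I : Finset (Fin n)) : SmallSubset n q → ℝ :=
  fun J => if J.1 ⊆ I then 1 else 0

/-- The matrix `∑_I z_I Z_I Z_Iᵀ`, with `Z_I` the `q`-zeta vectors. -/
def zetaMatrix {n : ℕ} (q : ℕ) (z : Finset (Fin n) → ℝ) :
    Matrix (SmallSubset n q) (SmallSubset n q) ℝ :=
  ∑ I : Finset (Fin n), z I • Matrix.vecMulVec (zetaVec q I) (zetaVec q I)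

/-- The feasible set of the `t`-th round SoS relaxation of the set given by the constraints `g`.
The matrix of the variables has order `t + d` with `d = 0` if there is no constraint, and `d = 1`
otherwise. -/
def SoS {n : ℕ} {ι : Type} [Fintype ι] (t : ℕ) (g : ι → LinConstraint n) :
    Set (Finset (Fin n) → ℝ) :=
  {y | ∑ I, y I = 1 ∧
    (zetaMatrix (t + if Fintype.card ι = 0 then 0 else 1) y).PosSemidef ∧
    ∀ l : ι, (zetaMatrix t (fun I => (g l).eval (zeroOnePoint I) * y I)).PosSemidef}

/-- The objective value `∑_I f(x_I) y_I` of `y`, for the objective function `f`. -/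
def objValue {n : ℕ} (f : (Fin n → ℝ) → ℝ) (y : Finset (Fin n) → ℝ) : ℝ :=
  ∑ I, f (zeroOnePoint I) * y I

/-- The optimal value of the `t`-th round SoS relaxation of `min f` subject to `g`. -/
def sosOpt {n : ℕ} {ι : Type} [Fintype ι] (t : ℕ) (f : (Fin n → ℝ) → ℝ)
    (g : ι → LinConstraint n) : ℝ :=
  sInf (objValue f '' SoS t g)

/-- The 0/1 points that satisfy all the constraints `g`. -/
def integralPoints {n : ℕ} {ι : Type} (g : ι → LinConstraint n) : Set (Fin n → ℝ) :=
  {x | (∃ I, x = zeroOnePoint I) ∧ ∀ l, 0 ≤ (g l).eval x}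

/-- The optimal integral value of `min f` subject to `g`. -/
def intOpt {n : ℕ} {ι : Type} (f : (Fin n → ℝ) → ℝ) (g : ι → LinConstraint n) : ℝ :=
  sInf (f '' integralPoints g)

/-- The projection of the `t`-th round SoS relaxation to the original variables,
`x_i = ∑_{I ∋ i} y_I`. -/
def sosProjection {n : ℕ} {ι : Type} [Fintype ι] (t : ℕ) (g : ι → LinConstraint n) :
    Set (Fin n → ℝ) :=
  (fun y i => objValue (fun x => x i) y) '' SoS t g

/-- The Lasserre rank: the least number of rounds after which the relaxation projects onto the
convex hull of the integral points (`⊤` if there is none). -/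
def lasserreRank {n : ℕ} {ι : Type} [Fintype ι] (g : ι → LinConstraint n) : ℕ∞ :=
  ⨅ (s : ℕ) (_ : sosProjection s g = convexHull ℝ (integralPoints g)), (s : ℕ∞)

/-- The Min-Knapsack objective `∑ x_j`. -/
def knapsackCost (n : ℕ) : (Fin n → ℝ) → ℝ := fun x => ∑ j, x j

/-- The constraints `∑ x_j ≥ P`, and `x_j ≥ 0` and `x_j ≤ 1` for all `j`. -/
def knapsackLP (n : ℕ) (P : ℝ) : Unit ⊕ Fin n ⊕ Fin n → LinConstraint n
  | .inl _ => ⟨fun _ => 1, P⟩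
  | .inr (.inl j) => ⟨Pi.single j 1, 0⟩
  | .inr (.inr j) => ⟨Pi.single j (-1), -1⟩

/-- The number of rounds `t = ⌊log^{1-δ} m⌋`. -/
def rounds (δ : ℝ) (m : ℕ) : ℕ := ⌊(Real.log m) ^ (1 - δ)⌋₊

/-- The number of items `n = ⌊m / t⌋ t`. -/
def items (δ : ℝ) (m : ℕ) : ℕ := (m / rounds δ m) * rounds δ m

/-- The total weight that the solution gives to the sets of size `k ≥ 1`: `(1 + ε) P / ⌊log n⌋` for
`k = ⌊log n⌋`, then `ε t / (j n)` for `k = j n / t` with `1 ≤ j ≤ t`, and `0` otherwise. -/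
def layerWeight (P ε : ℝ) (t n k : ℕ) : ℝ :=
  if k = ⌊Real.log n⌋₊ then (1 + ε) * P / (⌊Real.log n⌋₊ : ℝ)
  else ∑ j ∈ Finset.Icc 1 t, if k = j * (n / t) then ε * t / (j * n : ℝ) else 0

/-- The symmetric solution `y_I`. -/
def knapsackSolution (P ε : ℝ) (t n : ℕ) (I : Finset (Fin n)) : ℝ :=
  if I = ∅ then
    1 - ∑ J : Finset (Fin n) with J ≠ ∅, ((n.choose J.card : ℝ))⁻¹ * layerWeight P ε t n J.card
  else ((n.choose I.card : ℝ))⁻¹ * layerWeight P ε t n I.card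

end

/-!
The value of the symmetric solution is `(1 + ε) P + t ε`, which tends to `P`, while the integral
optimum is `1`. Everything therefore rests on feasibility, and there only the matrix of the
knapsack constraint `∑ x_j ≥ P` matters: `y` is nonnegative, so that the moment matrix and the
matrices of the box constraints are nonnegative combinations of the matrices `Z_I Z_Iᵀ`.

In the knapsack matrix only `I = ∅` has a negative coefficient, `-P y_∅`. For a vector `v` let
`p(I) = ∑_{J ⊆ I} v_J`, a polynomial of degree at most `t` on the cube. Its mean over the sets of
size `k` is `Q(k)` for a univariate polynomial `Q` of degree at most `t` (`layerMean_zetaPairing`),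
with `Q(0) = p(∅)`. By Jensen's inequality on the layers it suffices to bound `P y_∅ Q(0)²` by the
weighted sum of the squares of `Q` at the `t + 1` points `L = ⌊log n⌋` and `j n / t`, `1 ≤ j ≤ t`
(`polynomial_knapsack_inequality`).

These points determine `Q`, so Lagrange interpolation and the Cauchy–Schwarz inequality reduce
this to `∑ ℓ_i(0)² / a_i ≤ 1 / (P (1 - P / L))`, where `a_L = (1 + ε) P (1 - P / L)` and the other
weights `a_i` are at least `ε / 2` (`sum_sq_eval_basis_div_le`). As `L` is far below `n / t`,
`ℓ_L(0)` is `1 + O(t² L / n)`, and the other `ℓ_i(0)` are at most `2 t^t · L t / n`. The factor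
`1 + ε` in `a_L` absorbs both errors as soon as `8 t^(t + 1) L ≤ ε n / t`. For `t ≤ log^{1-δ} n'`
the number `t^t` is a subpolynomial function of `n'`, so that `ε = (n' + 1)^{-1/2}` will do
(`eventually_feasibility_condition`).

The bound `P` from below for the relaxation is the `(∅, ∅)` entry of the knapsack matrix. For the
rank, the relaxations shrink with the number of rounds, and the points of the integral hull have
cost at least `1`, so a solution of value below `1` rules out all rounds up to `t`.
-/

/-! ### Lagrange interpolation at the layers -/

open Polynomial in
/-- Lagrange interpolation followed by Cauchy–Schwarz with weights `a`. -/
theorem sq_eval_le_lagrange {ι : Type*} [DecidableEq ι] {S : Finset ι} {v a : ι → ℝ}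
    (hv : Set.InjOn v S) (ha : ∀ i ∈ S, 0 < a i) {Q : ℝ[X]} (hQ : Q.degree < S.card) (x : ℝ) :
    Q.eval x ^ 2 ≤
      (∑ i ∈ S, (Lagrange.basis S v i).eval x ^ 2 / a i) * ∑ i ∈ S, a i * Q.eval (v i) ^ 2 := by
  have h : Q.eval x = ∑ i ∈ S, Q.eval (v i) * (Lagrange.basis S v i).eval x := by
    conv_lhs => rw [Lagrange.eq_interpolate hv hQ]
    simp [Lagrange.interpolate_apply, eval_finsetSum]
  rw [h]
  refine Finset.sum_sq_le_sum_mul_sum_of_sq_le_mul S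
    (fun i hi => div_nonneg (sq_nonneg _) (ha i hi).le)
    (fun i hi => mul_nonneg (ha i hi).le (sq_nonneg _)) (fun i hi => le_of_eq ?_)
  have := (ha i hi).ne'
  field_simp

theorem eval_lagrange_basis {ι : Type*} [DecidableEq ι] (S : Finset ι) (v : ι → ℝ) (i : ι)
    (x : ℝ) : (Lagrange.basis S v i).eval x = ∏ j ∈ S.erase i, (x - v j) / (v i - v j) := by
  simp [Lagrange.basis, Lagrange.basisDivisor, Polynomial.eval_prod, div_eq_inv_mul]

/-- The interpolation nodes of the argument: the layer `L`, with index `0`, and the multiples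
`s, 2s, …` of `s`. -/
noncomputable def layerNode (L s : ℕ) (j : ℕ) : ℝ := if j = 0 then L else j * s

theorem layerNode_injective {L s : ℕ} (hL : 0 < L) (hLs : L < s) :
    Function.Injective (layerNode L s) := by
  have hs : (0 : ℝ) < s := by exact_mod_cast (by omega : 0 < s)
  have key : ∀ j : ℕ, j ≠ 0 → (L : ℝ) ≠ j * s := by
    intro j hj h
    have h' : L = j * s := by exact_mod_cast h
    have := Nat.le_mul_of_pos_left s (Nat.pos_of_ne_zero hj)
    omega
  intro i j hij
  unfold layerNode at hij
  split_ifs at hij with hi hj hj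
  · omega
  · exact absurd hij (key j hj)
  · exact absurd hij.symm (key i hi)
  · exact_mod_cast mul_right_cancel₀ hs.ne' hij

/-- At the node `L` the Lagrange polynomial is close to `1` at the origin. -/
theorem sq_eval_basis_zero_le {t L s : ℕ} (hL : 0 < L) (hLs : L < s)
    (h : 2 * t * (L / s : ℝ) < 1) :
    (Lagrange.basis (Finset.range (t + 1)) (layerNode L s) 0).eval 0 ^ 2 ≤
      (1 - 2 * t * (L / s : ℝ))⁻¹ := by
  have hs : (0 : ℝ) < s := by exact_mod_cast (by omega : 0 < s)
  have hL' : (0 : ℝ) < L := by exact_mod_cast hL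
  have hLs' : (L : ℝ) < s := by exact_mod_cast hLs
  have hx1 : (L / s : ℝ) < 1 := (div_lt_one hs).2 hLs'
  set x : ℝ := L / s with hx
  have hLx : (L : ℝ) = x * s := by rw [hx]; field_simp
  have hx0 : 0 < x := div_pos hL' hs
  have hb : |(Lagrange.basis (Finset.range (t + 1)) (layerNode L s) 0).eval 0| ≤
      ((1 - x)⁻¹) ^ t := by
    rw [eval_lagrange_basis, Finset.abs_prod]
    refine (Finset.prod_le_prod (fun _ _ => abs_nonneg _) (g := fun _ => (1 - x)⁻¹) ?_).trans ?_
    · intro j hj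
      have hj0 : j ≠ 0 := (Finset.mem_erase.1 hj).1
      have hj1 : (1 : ℝ) ≤ j := by exact_mod_cast Nat.one_le_iff_ne_zero.2 hj0
      have hjx : x < j := by linarith
      have e : (0 - layerNode L s j) / (layerNode L s 0 - layerNode L s j) = j / (j - x) := by
        simp only [layerNode, hj0, if_true, if_false, hLx]
        rw [← neg_div_neg_eq, ← mul_div_mul_right (j : ℝ) (j - x) hs.ne']
        congr 1 <;> ring
      rw [e, abs_of_nonneg (div_nonneg (by linarith) (by linarith)), ← one_div,
        div_le_div_iff₀ (by linarith) (by linarith)]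
      nlinarith
    · rw [Finset.prod_const, Finset.card_erase_of_mem (by simp), Finset.card_range]
      simp
  -- Bernoulli's inequality
  have hB : 1 - 2 * t * x ≤ (1 - x) ^ (2 * t) := by
    have := one_add_mul_le_pow (a := -x) (by linarith) (2 * t)
    push_cast at this
    rw [← sub_eq_add_neg] at this
    linarith
  calc _ = |(Lagrange.basis (Finset.range (t + 1)) (layerNode L s) 0).eval 0| ^ 2 :=
        (sq_abs _).symm
    _ ≤ (((1 - x)⁻¹) ^ t) ^ 2 := by gcongr
    _ = ((1 - x) ^ (2 * t))⁻¹ := by rw [← pow_mul, inv_pow, mul_comm]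
    _ ≤ _ := inv_anti₀ (by linarith) hB

/-- At the nodes `i s` the Lagrange polynomials are small at the origin. The factor of the node `L`
is of order `L / s`, and each of the `t - 1` other factors `j / (j - i)` is at most `t`. -/
theorem abs_eval_basis_le {t L s i : ℕ} (hL : 0 < L) (hLs : 2 * L ≤ s) (hi : i ∈ Finset.Icc 1 t) :
    |(Lagrange.basis (Finset.range (t + 1)) (layerNode L s) i).eval 0| ≤
      2 * (L / s : ℝ) * t ^ t := by
  obtain ⟨hi1, hit⟩ := Finset.mem_Icc.1 hi
  have hs : (0 : ℝ) < s := by exact_mod_cast (by omega : 0 < s)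
  have hL' : (0 : ℝ) < L := by exact_mod_cast hL
  have hLs' : 2 * (L : ℝ) ≤ s := by exact_mod_cast hLs
  have hi' : (1 : ℝ) ≤ i := by exact_mod_cast hi1
  have ht' : (1 : ℝ) ≤ t := by exact_mod_cast hi1.trans hit
  have h0 : 0 ∈ (Finset.range (t + 1)).erase i := by simp; omega
  rw [eval_lagrange_basis, Finset.abs_prod, ← Finset.mul_prod_erase _ _ h0]
  refine mul_le_mul ?_ ?_ (Finset.prod_nonneg fun _ _ => abs_nonneg _) (by positivity)
  · have hi0 : i ≠ 0 := by omega
    simp only [layerNode, hi0, if_true, if_false]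
    have his : (s : ℝ) ≤ i * s := by nlinarith
    rw [abs_div, zero_sub, abs_neg, abs_of_pos hL', abs_of_pos (by linarith), ← mul_div_assoc,
      div_le_div_iff₀ (by linarith) hs]
    nlinarith
  · refine (Finset.prod_le_prod (fun _ _ => abs_nonneg _) (g := fun _ => (t : ℝ)) ?_).trans ?_
    · intro j hj
      simp only [Finset.mem_erase, Finset.mem_range] at hj
      obtain ⟨hj0, hji, hjt⟩ := hj
      have hi0 : i ≠ 0 := by omega
      simp only [layerNode, hj0, hi0, if_false]
      have hd : (1 : ℝ) ≤ |(i : ℝ) - j| := by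
        have : (1 : ℤ) ≤ |(i : ℤ) - j| := Int.one_le_abs (by omega)
        exact_mod_cast this
      have hjt' : (j : ℝ) ≤ t := by exact_mod_cast (by omega : j ≤ t)
      rw [← sub_mul, abs_div, zero_sub, abs_neg, abs_mul, abs_mul,
        mul_div_mul_right _ _ (abs_pos.2 hs.ne').ne', Nat.abs_cast]
      exact (div_le_self (by positivity) hd).trans hjt'
    · rw [Finset.prod_const]
      refine pow_le_pow_right₀ ht' ?_
      rw [Finset.card_erase_of_mem h0, Finset.card_erase_of_mem (by simp; omega), Finset.card_range]
      omega

/-- The coefficient bound that the Cauchy–Schwarz step needs, for weights `(1 + ε) K` at the node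
`L` and at least `ε / 2` at the other nodes: the node `L` contributes at most `(1 - ε / 4) / K`, and
the other `t` nodes together at most `ε / 4`. -/
theorem sum_sq_eval_basis_div_le {ε K : ℝ} {t s L : ℕ} {a : ℕ → ℝ} (hL : 1 ≤ L) (ht : 1 ≤ t)
    (hε0 : 0 < ε) (hε1 : ε ≤ 1) (hs : 8 * (t : ℝ) ^ (t + 1) * L ≤ ε * s)
    (hK0 : 0 < K) (hK1 : K ≤ 1) (ha0 : a 0 = (1 + ε) * K)
    (ha : ∀ j ∈ Finset.Icc 1 t, ε / 2 ≤ a j) :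
    ∑ i ∈ Finset.range (t + 1),
      (Lagrange.basis (Finset.range (t + 1)) (layerNode L s) i).eval 0 ^ 2 / a i ≤ K⁻¹ := by
  have hL' : (1 : ℝ) ≤ L := by exact_mod_cast hL
  have ht' : (1 : ℝ) ≤ t := by exact_mod_cast ht
  have htt : (1 : ℝ) ≤ (t : ℝ) ^ t := one_le_pow₀ ht'
  have htt1 : (t : ℝ) ≤ (t : ℝ) ^ (t + 1) := by rw [pow_succ]; nlinarith
  have hs8 : 8 * (t : ℝ) * L ≤ ε * s := by
    refine le_trans ?_ hs; gcongr
  have htL : 1 ≤ (t : ℝ) * L := one_le_mul_of_one_le_of_one_le ht' hL'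
  have hs0 : (0 : ℝ) < s := by
    by_contra hcon
    have : ε * s ≤ 0 := mul_nonpos_of_nonneg_of_nonpos hε0.le (not_lt.1 hcon)
    linarith
  have hsL : 8 * (L : ℝ) ≤ s := by nlinarith
  have hLs : 8 * L ≤ s := by exact_mod_cast hsL
  have hx1 : t * (L / s : ℝ) ≤ ε / 8 := by
    rw [← mul_div_assoc, div_le_div_iff₀ hs0 (by norm_num)]; linarith
  have hx2 : (t : ℝ) ^ (t + 1) * (L / s : ℝ) ≤ ε / 8 := by
    rw [← mul_div_assoc, div_le_div_iff₀ hs0 (by norm_num)]; linarith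
  have hrange : Finset.range (t + 1) = insert 0 (Finset.Icc 1 t) := by
    ext j; simp; omega
  have h0 : 0 ∉ Finset.Icc 1 t := by simp
  have h1 : (Lagrange.basis (Finset.range (t + 1)) (layerNode L s) 0).eval 0 ^ 2 / a 0 ≤
      (1 - ε / 4) * K⁻¹ := by
    have hb := sq_eval_basis_zero_le (t := t) (L := L) (s := s) (by omega) (by omega) (by linarith)
    rw [ha0, ← div_eq_mul_inv, ← div_div]
    refine div_le_div_of_nonneg_right ?_ hK0.le
    rw [div_le_iff₀ (by linarith)]
    refine hb.trans ?_
    have h4 : 1 - ε / 4 ≤ 1 - 2 * t * (L / s : ℝ) := by linarith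
    refine (inv_anti₀ (by linarith) h4).trans ?_
    rw [inv_le_iff_one_le_mul₀ (by linarith)]
    nlinarith [mul_nonneg hε0.le (sub_nonneg.2 hε1), mul_pos hε0 hε0,
      mul_nonneg (mul_pos hε0 hε0).le (sub_nonneg.2 hε1)]
  have hterm : ∀ i ∈ Finset.Icc 1 t,
      (Lagrange.basis (Finset.range (t + 1)) (layerNode L s) i).eval 0 ^ 2 / a i ≤
        ε / (4 * t) := by
    intro i hi
    have hb := abs_eval_basis_le (s := s) (by omega : 0 < L) (by omega) hi
    have hb2 : 2 * (L / s : ℝ) * t ^ t ≤ ε / (4 * t) := by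
      rw [le_div_iff₀ (by positivity)]
      rw [pow_succ] at hx2
      linarith
    have hq : ε / (4 * t) ≤ ε / 2 := div_le_div_of_nonneg_left hε0.le two_pos (by linarith)
    have hq0 : 0 ≤ ε / (4 * t) := by positivity
    rw [← sq_abs, div_le_iff₀ (by linarith [ha i hi]), sq]
    exact mul_le_mul (hb.trans hb2) ((hb.trans hb2).trans (hq.trans (ha i hi))) (abs_nonneg _) hq0
  have h2 : ∑ i ∈ Finset.Icc 1 t,
      (Lagrange.basis (Finset.range (t + 1)) (layerNode L s) i).eval 0 ^ 2 / a i ≤ ε / 4 := by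
    refine (Finset.sum_le_sum hterm).trans (le_of_eq ?_)
    rw [Finset.sum_const, Nat.card_Icc, nsmul_eq_mul, Nat.add_sub_cancel]
    field_simp
  have h3 : 1 ≤ K⁻¹ := (one_le_inv₀ hK0).2 hK1
  calc _ = (Lagrange.basis (Finset.range (t + 1)) (layerNode L s) 0).eval 0 ^ 2 / a 0 +
        ∑ i ∈ Finset.Icc 1 t,
          (Lagrange.basis (Finset.range (t + 1)) (layerNode L s) i).eval 0 ^ 2 / a i := by
        conv_lhs => rw [show ∀ f : ℕ → ℝ, ∑ i ∈ Finset.range (t + 1), f i =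
          f 0 + ∑ i ∈ Finset.Icc 1 t, f i from fun f => by rw [hrange, Finset.sum_insert h0]]
    _ ≤ (1 - ε / 4) * K⁻¹ + ε / 4 * K⁻¹ :=
        add_le_add h1 (h2.trans (le_mul_of_one_le_right (by linarith) h3))
    _ = K⁻¹ := by ring

/-! ### The univariate inequality -/

open Polynomial in
/-- The univariate inequality behind the knapsack constraint: a polynomial of degree at most `t`
cannot have a large value at `0` unless it has a large value at one of the `t + 1` nodes. -/
theorem polynomial_knapsack_inequality {P ε y₀ : ℝ} {t s L : ℕ} (hP0 : 0 < P) (hP1 : P < 1)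
    (hL : 1 ≤ L) (ht : 1 ≤ t) (hε0 : 0 < ε) (hε1 : ε ≤ 1)
    (hs : 8 * (t : ℝ) ^ (t + 1) * L ≤ ε * s) (hy : y₀ ≤ 1 - P / L)
    {Q : ℝ[X]} (hQ : Q.natDegree ≤ t) :
    P * y₀ * Q.eval 0 ^ 2 ≤ (1 + ε) * P / L * ((L - P) * Q.eval (L : ℝ) ^ 2) +
      ∑ j ∈ Finset.Icc 1 t, ε / (j * s) * ((j * s - P) * Q.eval (j * s : ℝ) ^ 2) := by
  have hL' : (1 : ℝ) ≤ L := by exact_mod_cast hL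
  have ht' : (1 : ℝ) ≤ (t : ℝ) ^ (t + 1) := one_le_pow₀ (by exact_mod_cast ht)
  have hs8 : 8 * (L : ℝ) ≤ s := by
    have : ε * s ≤ s := mul_le_of_le_one_left (by positivity) hε1
    nlinarith
  have hLs : L < s := by
    have : 8 * L ≤ s := by exact_mod_cast hs8
    omega
  have hs0 : (0 : ℝ) < s := by linarith
  have hPL : P / L < 1 := by rw [div_lt_one (by linarith)]; linarith
  have hPL0 : 0 < P / L := by positivity
  obtain ⟨K, hK⟩ : ∃ K, K = P * (1 - P / L) := ⟨_, rfl⟩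
  have hK0 : 0 < K := hK ▸ mul_pos hP0 (by linarith)
  have hK1 : K ≤ 1 := by rw [hK]; nlinarith
  obtain ⟨a, ha⟩ : ∃ a : ℕ → ℝ, a = fun j : ℕ => if j = 0 then (1 + ε) * K
    else ε * (1 - P / (j * s)) := ⟨_, rfl⟩
  have haj : ∀ j ∈ Finset.Icc 1 t, ε / 2 ≤ a j := by
    intro j hj
    have hj0 : j ≠ 0 := by have := (Finset.mem_Icc.1 hj).1; omega
    have hj1 : (1 : ℝ) ≤ j := by exact_mod_cast (Finset.mem_Icc.1 hj).1
    have : P / (j * s) ≤ 1 / 2 := by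
      rw [div_le_div_iff₀ (by positivity) (by norm_num)]; nlinarith
    simp only [ha, hj0, if_false]
    nlinarith
  have hrange : Finset.range (t + 1) = insert 0 (Finset.Icc 1 t) := by
    ext j; simp; omega
  have h0 : 0 ∉ Finset.Icc 1 t := by simp
  have ha0 : a 0 = (1 + ε) * K := by simp [ha]
  have hapos : ∀ j ∈ Finset.range (t + 1), 0 < a j := by
    intro j hj
    rw [hrange, Finset.mem_insert] at hj
    obtain rfl | hj := hj
    · rw [ha0]; positivity
    · linarith [haj j hj]
  have hdeg : Q.degree < (Finset.range (t + 1)).card := by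
    rw [Finset.card_range]
    exact (degree_le_of_natDegree_le hQ).trans_lt (by exact_mod_cast Nat.lt_succ_self t)
  have main := sq_eval_le_lagrange (v := layerNode L s)
    (layerNode_injective (by omega) hLs).injOn hapos hdeg 0
  have hcoef := sum_sq_eval_basis_div_le hL ht hε0 hε1 hs hK0 hK1 ha0 haj
  have hW : ∑ i ∈ Finset.range (t + 1), a i * Q.eval (layerNode L s i) ^ 2 =
      (1 + ε) * P / L * ((L - P) * Q.eval (L : ℝ) ^ 2) +
      ∑ j ∈ Finset.Icc 1 t, ε / (j * s) * ((j * s - P) * Q.eval (j * s : ℝ) ^ 2) := by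
    rw [hrange, Finset.sum_insert h0]
    congr 1
    · simp only [ha0, layerNode, if_true, hK]
      field_simp
    · refine Finset.sum_congr rfl fun j hj => ?_
      have hj1 : 1 ≤ j := (Finset.mem_Icc.1 hj).1
      have hj0 : j ≠ 0 := by omega
      have : (j : ℝ) ≠ 0 := by exact_mod_cast hj0
      simp only [ha, layerNode, hj0, if_false]
      field_simp
  have hW0 : 0 ≤ ∑ i ∈ Finset.range (t + 1), a i * Q.eval (layerNode L s i) ^ 2 :=
    Finset.sum_nonneg fun i hi => mul_nonneg (hapos i hi).le (sq_nonneg _)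
  rw [← hW]
  have hPy : P * y₀ ≤ K := by rw [hK]; gcongr
  refine (mul_le_mul_of_nonneg_right hPy (sq_nonneg _)).trans ?_
  rw [← le_inv_mul_iff₀ hK0]
  exact main.trans (mul_le_mul_of_nonneg_right hcoef hW0)

/-! ### Quadratic forms of zeta matrices -/

/-- The value at `x_I` of the multilinear polynomial with coefficient vector `v`, that is, the sum
of `v J` over the `J ⊆ I` of size at most `q`. -/
noncomputable def zetaPairing {n q : ℕ} (v : SmallSubset n q → ℝ) (I : Finset (Fin n)) : ℝ :=
  ∑ J, zetaVec q I J * v J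

theorem isHermitian_zetaMatrix {n q : ℕ} (z : Finset (Fin n) → ℝ) :
    (zetaMatrix q z).IsHermitian := by
  ext J K
  simp [zetaMatrix, Matrix.sum_apply, Matrix.vecMulVec_apply, mul_comm]

theorem dotProduct_zetaMatrix_mulVec {n q : ℕ} (z : Finset (Fin n) → ℝ) (v : SmallSubset n q → ℝ) :
    v ⬝ᵥ (zetaMatrix q z).mulVec v = ∑ I, z I * zetaPairing v I ^ 2 := by
  simp only [zetaMatrix, Matrix.sum_mulVec, Matrix.smul_mulVec, dotProduct_sum, dotProduct_smul,
    smul_eq_mul]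
  refine Finset.sum_congr rfl fun I _ => ?_
  rw [Matrix.vecMulVec_mulVec]
  have : zetaVec q I ⬝ᵥ v = zetaPairing v I := rfl
  rw [dotProduct_smul, dotProduct_comm v, this]
  simp [sq]

theorem posSemidef_zetaMatrix_iff {n q : ℕ} {z : Finset (Fin n) → ℝ} :
    (zetaMatrix q z).PosSemidef ↔
      ∀ v : SmallSubset n q → ℝ, 0 ≤ ∑ I, z I * zetaPairing v I ^ 2 := by
  rw [Matrix.posSemidef_iff_dotProduct_mulVec]
  simp only [star_trivial, dotProduct_zetaMatrix_mulVec, isHermitian_zetaMatrix, true_and]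

theorem posSemidef_zetaMatrix_of_nonneg {n q : ℕ} {z : Finset (Fin n) → ℝ} (hz : ∀ I, 0 ≤ z I) :
    (zetaMatrix q z).PosSemidef :=
  posSemidef_zetaMatrix_iff.2 fun _ => Finset.sum_nonneg fun I _ => mul_nonneg (hz I) (sq_nonneg _)

theorem zetaMatrix_posSemidef_anti {n q q' : ℕ} (h : q ≤ q') {z : Finset (Fin n) → ℝ}
    (hz : (zetaMatrix q' z).PosSemidef) : (zetaMatrix q z).PosSemidef := by
  have : zetaMatrix q z = (zetaMatrix q' z).submatrix
      (fun J : SmallSubset n q => (⟨J.1, J.2.trans h⟩ : SmallSubset n q'))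
      (fun J : SmallSubset n q => (⟨J.1, J.2.trans h⟩ : SmallSubset n q')) := by
    ext J K
    simp [zetaMatrix, Matrix.sum_apply, Matrix.vecMulVec_apply, zetaVec]
  exact this ▸ hz.submatrix _

/-- The relaxations shrink as the number of rounds grows. -/
theorem SoS_anti {n : ℕ} {ι : Type} [Fintype ι] (g : ι → LinConstraint n) {s t : ℕ} (h : s ≤ t) :
    SoS t g ⊆ SoS s g := fun _ hy =>
  ⟨hy.1, zetaMatrix_posSemidef_anti (Nat.add_le_add_right h _) hy.2.1,
    fun l => zetaMatrix_posSemidef_anti h (hy.2.2 l)⟩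

/-! ### Averages over layers -/

/-- The average of `h` over the sets of size `k`, for `k ≤ n`. -/
noncomputable def layerMean (n k : ℕ) (h : Finset (Fin n) → ℝ) : ℝ :=
  (n.choose k : ℝ)⁻¹ * ∑ I ∈ Finset.univ.powersetCard k, h I

theorem layerMean_of_card {n k : ℕ} (hk : k ≤ n) {h : Finset (Fin n) → ℝ} {c : ℝ}
    (hc : ∀ I, I.card = k → h I = c) : layerMean n k h = c := by
  have h0 : (n.choose k : ℝ) ≠ 0 := by exact_mod_cast (Nat.choose_pos hk).ne'
  rw [layerMean, Finset.sum_congr rfl fun I hI => hc I (Finset.mem_powersetCard.1 hI).2]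
  simp [h0]

theorem layerMean_mul_of_card {n k : ℕ} {g h : Finset (Fin n) → ℝ} {c : ℝ}
    (hc : ∀ I, I.card = k → g I = c) :
    layerMean n k (fun I => g I * h I) = c * layerMean n k h := by
  rw [layerMean, layerMean, Finset.sum_congr rfl fun I hI =>
    congrArg (· * h I) (hc I (Finset.mem_powersetCard.1 hI).2), ← Finset.mul_sum]
  ring

theorem sq_layerMean_le {n k : ℕ} (h : Finset (Fin n) → ℝ) :
    layerMean n k h ^ 2 ≤ layerMean n k fun I => h I ^ 2 := by
  have := sum_div_card_sq_le_sum_sq_div_card (s := (Finset.univ : Finset (Fin n)).powersetCard k)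
    (f := h)
  rw [Finset.card_powersetCard, Finset.card_univ, Fintype.card_fin] at this
  simpa [layerMean, div_eq_inv_mul] using this

/-- The sets of size `k` that contain a fixed set of size `i` are counted by a binomial coefficient,
and make up the proportion `k (k - 1) ⋯ (k - i + 1) / (n (n - 1) ⋯ (n - i + 1))` of all sets of
size `k`. -/
theorem layerMean_subset {n k : ℕ} (hk : k ≤ n) (J : Finset (Fin n)) :
    layerMean n k (fun I => if J ⊆ I then 1 else 0) =
      (k.descFactorial J.card : ℝ) / n.descFactorial J.card := by
  have hJn : J.card ≤ n := by simpa using J.card_le_univ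
  have hd : (n.descFactorial J.card : ℝ) ≠ 0 := by
    exact_mod_cast Nat.descFactorial_eq_zero_iff_lt.not.2 (not_lt.2 hJn)
  have hc : (n.choose k : ℝ) ≠ 0 := by exact_mod_cast (Nat.choose_pos hk).ne'
  rw [layerMean, Finset.sum_boole]
  by_cases hJk : J.card ≤ k
  · have hcard : (((Finset.univ : Finset (Fin n)).powersetCard k).filter (J ⊆ ·)).card =
        (n - J.card).choose (k - J.card) := by
      have hJc : Jᶜ.card = n - J.card := by rw [Finset.card_compl, Fintype.card_fin]
      rw [← hJc, ← Finset.card_powersetCard]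
      refine Finset.card_nbij' (fun I => I \ J) (fun I => I ∪ J) ?_ ?_ ?_ ?_
      · intro I hI
        simp only [Finset.coe_filter, Finset.mem_powersetCard, Set.mem_ofPred_eq] at hI
        simp only [Finset.mem_coe, Finset.mem_powersetCard]
        refine ⟨?_, by rw [Finset.card_sdiff_of_subset hI.2, hI.1.2]⟩
        intro x hx
        simp only [Finset.mem_sdiff] at hx
        simpa using hx.2
      · intro I hI
        simp only [Finset.mem_coe, Finset.mem_powersetCard] at hI
        simp only [Finset.coe_filter, Finset.mem_powersetCard, Set.mem_ofPred_eq]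
        refine ⟨⟨Finset.subset_univ _, ?_⟩, Finset.subset_union_right⟩
        rw [Finset.card_union_of_disjoint, hI.2]
        · omega
        · exact Finset.disjoint_left.2 fun x hx => by simpa using hI.1 hx
      · intro I hI
        simp only [Finset.coe_filter, Set.mem_ofPred_eq] at hI
        exact Finset.sdiff_union_of_subset hI.2
      · intro I hI
        simp only [Finset.mem_coe, Finset.mem_powersetCard] at hI
        refine Finset.union_sdiff_cancel_right ?_
        exact Finset.disjoint_left.2 fun x hx => by simpa using hI.1 hx
    have hm : (n.choose k : ℝ) * k.choose J.card =
        n.choose J.card * (n - J.card).choose (k - J.card) := by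
      exact_mod_cast Nat.choose_mul hJk
    rw [hcard, inv_mul_eq_div, div_eq_div_iff hc hd, Nat.descFactorial_eq_factorial_mul_choose,
      Nat.descFactorial_eq_factorial_mul_choose]
    push_cast
    linear_combination -(J.card.factorial : ℝ) * hm
  · have hempty : ((Finset.univ : Finset (Fin n)).powersetCard k).filter (J ⊆ ·) = ∅ := by
      refine Finset.filter_false_of_mem fun I hI hJI => hJk ?_
      exact (Finset.card_le_card hJI).trans (Finset.mem_powersetCard.1 hI).2.le
    rw [hempty, Nat.descFactorial_of_lt (by omega : k < J.card)]
    simp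

open Polynomial in
/-- The univariate polynomial that takes the layer means of `zetaPairing v` as its values at
`0, …, n`. -/
noncomputable def layerPolynomial {n q : ℕ} (v : SmallSubset n q → ℝ) : ℝ[X] :=
  ∑ J : SmallSubset n q, C (v J / n.descFactorial J.1.card) * descPochhammer ℝ J.1.card

theorem natDegree_layerPolynomial_le {n q : ℕ} (v : SmallSubset n q → ℝ) :
    (layerPolynomial v).natDegree ≤ q := by
  refine Polynomial.natDegree_sum_le_of_forall_le _ _ fun J _ => ?_
  refine (Polynomial.natDegree_C_mul_le _ _).trans ?_
  rw [descPochhammer_natDegree]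
  exact J.2

theorem layerMean_zetaPairing {n q k : ℕ} (hk : k ≤ n) (v : SmallSubset n q → ℝ) :
    layerMean n k (zetaPairing v) = (layerPolynomial v).eval (k : ℝ) := by
  simp only [layerPolynomial, Polynomial.eval_finsetSum, Polynomial.eval_mul, Polynomial.eval_C,
    descPochhammer_eval_eq_descFactorial]
  unfold layerMean zetaPairing
  rw [Finset.sum_comm, Finset.mul_sum]
  refine Finset.sum_congr rfl fun J _ => ?_
  have := layerMean_subset hk J.1
  rw [layerMean] at this
  rw [← Finset.sum_mul, ← mul_assoc]
  simp only [zetaVec]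
  rw [this]
  ring

theorem zetaPairing_empty {n q : ℕ} (v : SmallSubset n q → ℝ) :
    zetaPairing v ∅ = (layerPolynomial v).eval 0 := by
  have h := layerMean_zetaPairing (Nat.zero_le n) v
  rw [Nat.cast_zero] at h
  rw [← h]
  refine (layerMean_of_card (Nat.zero_le n) fun I hI => ?_).symm
  rw [Finset.card_eq_zero.1 hI]

theorem sum_eq_sum_layerMean {n : ℕ} (w : ℕ → ℝ) (h : Finset (Fin n) → ℝ) :
    ∑ I : Finset (Fin n), (n.choose I.card : ℝ)⁻¹ * w I.card * h I =
      ∑ k ∈ Finset.range (n + 1), w k * layerMean n k h := by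
  rw [← Finset.powerset_univ, Finset.sum_powerset, Finset.card_univ, Fintype.card_fin]
  refine Finset.sum_congr rfl fun k _ => ?_
  rw [layerMean, Finset.mul_sum, Finset.mul_sum]
  refine Finset.sum_congr rfl fun I hI => ?_
  rw [(Finset.mem_powersetCard.1 hI).2]
  ring

/-! ### The symmetric solution -/

/-- When `⌊log n⌋ < n / t`, the layers in the definition of `layerWeight` are distinct. -/
theorem layerWeight_eq {P ε : ℝ} {t n : ℕ} (hLs : ⌊Real.log n⌋₊ < n / t) (k : ℕ) :
    layerWeight P ε t n k =
      (if k = ⌊Real.log n⌋₊ then (1 + ε) * P / (⌊Real.log n⌋₊ : ℝ) else 0) +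
        ∑ j ∈ Finset.Icc 1 t, if k = j * (n / t) then ε * t / (j * n : ℝ) else 0 := by
  unfold layerWeight
  split_ifs with h
  · rw [Finset.sum_eq_zero, add_zero]
    intro j hj
    have := Nat.le_mul_of_pos_left (n / t) (Finset.mem_Icc.1 hj).1
    rw [if_neg (by omega)]
  · rw [zero_add]

theorem layerWeight_zero {P ε : ℝ} {t n : ℕ} (hLs : ⌊Real.log n⌋₊ < n / t)
    (hL : 1 ≤ ⌊Real.log n⌋₊) : layerWeight P ε t n 0 = 0 := by
  rw [layerWeight_eq hLs 0, if_neg (by omega), zero_add]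
  refine Finset.sum_eq_zero fun j hj => if_neg ?_
  have := Nat.le_mul_of_pos_left (n / t) (Finset.mem_Icc.1 hj).1
  omega

/-- Expectations of nonempty sets under the symmetric solution, in terms of layer means. -/
theorem sum_layerWeight {P ε : ℝ} {t n s : ℕ} (hn : n = t * s) (ht : 1 ≤ t)
    (hL : 1 ≤ ⌊Real.log n⌋₊) (hLs : ⌊Real.log n⌋₊ < s) (h : Finset (Fin n) → ℝ) :
    ∑ I : Finset (Fin n) with I ≠ ∅, (n.choose I.card : ℝ)⁻¹ * layerWeight P ε t n I.card * h I =
      (1 + ε) * P / (⌊Real.log n⌋₊ : ℝ) * layerMean n ⌊Real.log n⌋₊ h +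
        ∑ j ∈ Finset.Icc 1 t, ε / (j * s : ℝ) * layerMean n (j * s) h := by
  have hs : n / t = s := by rw [hn, Nat.mul_div_cancel_left _ ht]
  have hLs' : ⌊Real.log n⌋₊ < n / t := hs.symm ▸ hLs
  have ht' : (t : ℝ) ≠ 0 := by exact_mod_cast (by omega : t ≠ 0)
  have hnr : (n : ℝ) = t * s := by exact_mod_cast hn
  have hall : ∑ I : Finset (Fin n) with I ≠ ∅,
      (n.choose I.card : ℝ)⁻¹ * layerWeight P ε t n I.card * h I =
      ∑ I : Finset (Fin n), (n.choose I.card : ℝ)⁻¹ * layerWeight P ε t n I.card * h I := by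
    refine Finset.sum_subset (Finset.filter_subset _ _) fun I _ hI => ?_
    have : I = ∅ := by simpa using hI
    simp [this, layerWeight_zero hLs' hL]
  have hsn : s ≤ n := by rw [hn]; exact Nat.le_mul_of_pos_left s ht
  rw [hall, sum_eq_sum_layerMean]
  simp only [layerWeight_eq hLs' _, add_mul, Finset.sum_add_distrib, Finset.sum_mul, ite_mul,
    zero_mul, hs]
  congr 1
  · rw [Finset.sum_ite_eq', if_pos (Finset.mem_range.2 (by omega))]
  · rw [Finset.sum_comm]
    refine Finset.sum_congr rfl fun j hj => ?_
    have hjt : j * s ≤ n := by rw [hn]; exact Nat.mul_le_mul_right s (Finset.mem_Icc.1 hj).2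
    rw [Finset.sum_ite_eq', if_pos (Finset.mem_range.2 (by omega)), hnr]
    congr 1
    field_simp

/-- The mass that the symmetric solution gives to the empty set. -/
theorem knapsackSolution_empty {P ε : ℝ} {t n s : ℕ} (hn : n = t * s) (ht : 1 ≤ t)
    (hL : 1 ≤ ⌊Real.log n⌋₊) (hLs : ⌊Real.log n⌋₊ < s) :
    knapsackSolution P ε t n ∅ = 1 - ((1 + ε) * P / (⌊Real.log n⌋₊ : ℝ) +
        ∑ j ∈ Finset.Icc 1 t, ε / (j * s : ℝ)) := by
  have h := sum_layerWeight (P := P) (ε := ε) hn ht hL hLs fun _ => 1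
  have hsn : s ≤ n := by rw [hn]; exact Nat.le_mul_of_pos_left s ht
  simp only [mul_one] at h
  rw [knapsackSolution, if_pos rfl, h,
    layerMean_of_card (c := 1) (by omega) fun _ _ => rfl, mul_one]
  congr 2
  refine Finset.sum_congr rfl fun j hj => ?_
  have hjt : j * s ≤ n := by rw [hn]; exact Nat.mul_le_mul_right s (Finset.mem_Icc.1 hj).2
  rw [layerMean_of_card (c := 1) hjt fun _ _ => rfl, mul_one]

/-- Expectations under the symmetric solution, in terms of layer means. -/
theorem sum_knapsackSolution {P ε : ℝ} {t n s : ℕ} (hn : n = t * s) (ht : 1 ≤ t)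
    (hL : 1 ≤ ⌊Real.log n⌋₊) (hLs : ⌊Real.log n⌋₊ < s) (h : Finset (Fin n) → ℝ) :
    ∑ I, knapsackSolution P ε t n I * h I = knapsackSolution P ε t n ∅ * h ∅ +
      ((1 + ε) * P / (⌊Real.log n⌋₊ : ℝ) * layerMean n ⌊Real.log n⌋₊ h +
        ∑ j ∈ Finset.Icc 1 t, ε / (j * s : ℝ) * layerMean n (j * s) h) := by
  rw [← sum_layerWeight hn ht hL hLs h,
    ← Finset.sum_filter_add_sum_filter_not Finset.univ (fun I : Finset (Fin n) => I = ∅)]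
  congr 1
  · simp [Finset.filter_eq']
  · refine Finset.sum_congr rfl fun I hI => ?_
    rw [knapsackSolution, if_neg (Finset.mem_filter.1 hI).2]

theorem sum_knapsackSolution_eq_one {P ε : ℝ} {t n : ℕ} : ∑ I, knapsackSolution P ε t n I = 1 := by
  rw [← Finset.sum_filter_add_sum_filter_not Finset.univ (fun I : Finset (Fin n) => I = ∅)]
  have h : ∑ I : Finset (Fin n) with ¬ I = ∅, knapsackSolution P ε t n I =
      ∑ J : Finset (Fin n) with J ≠ ∅, ((n.choose J.card : ℝ))⁻¹ * layerWeight P ε t n J.card :=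
    Finset.sum_congr rfl fun I hI => if_neg (Finset.mem_filter.1 hI).2
  rw [h]
  simp [Finset.filter_eq', knapsackSolution]

theorem layerWeight_nonneg {P ε : ℝ} {t n : ℕ} (hP : 0 ≤ P) (hε : 0 ≤ ε) (k : ℕ) :
    0 ≤ layerWeight P ε t n k := by
  unfold layerWeight
  split_ifs
  · positivity
  · exact Finset.sum_nonneg fun j _ => by split_ifs <;> positivity

theorem knapsackLP_eval_zeroOnePoint {n : ℕ} (P : ℝ) (u : Unit) (I : Finset (Fin n)) :
    (knapsackLP n P (.inl u)).eval (zeroOnePoint I) = I.card - P := by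
  simp [knapsackLP, LinConstraint.eval, zeroOnePoint]

theorem knapsackCost_zeroOnePoint {n : ℕ} (I : Finset (Fin n)) :
    knapsackCost n (zeroOnePoint I) = I.card := by
  simp [knapsackCost, zeroOnePoint]

theorem objValue_knapsackSolution {P ε : ℝ} {t n s : ℕ} (hn : n = t * s) (ht : 1 ≤ t)
    (hL : 1 ≤ ⌊Real.log n⌋₊) (hLs : ⌊Real.log n⌋₊ < s) :
    objValue (knapsackCost n) (knapsackSolution P ε t n) = (1 + ε) * P + t * ε := by
  have hsn : s ≤ n := by rw [hn]; exact Nat.le_mul_of_pos_left s ht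
  have hs : (s : ℝ) ≠ 0 := by exact_mod_cast (by omega : s ≠ 0)
  have hL' : (⌊Real.log n⌋₊ : ℝ) ≠ 0 := by exact_mod_cast (by omega : ⌊Real.log n⌋₊ ≠ 0)
  simp only [objValue, knapsackCost_zeroOnePoint]
  simp only [mul_comm _ (knapsackSolution P ε t n _)]
  rw [sum_knapsackSolution hn ht hL hLs,
    layerMean_of_card (c := ⌊Real.log n⌋₊) (by omega) fun I hI => by rw [hI],
    div_mul_cancel₀ _ hL', Finset.sum_congr rfl (g := fun _ => ε)]
  · simp
  · intro j hj
    have hj0 : (j : ℝ) ≠ 0 := by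
      exact_mod_cast (by have := (Finset.mem_Icc.1 hj).1; omega : j ≠ 0)
    have hjt : j * s ≤ n := by rw [hn]; exact Nat.mul_le_mul_right s (Finset.mem_Icc.1 hj).2
    rw [layerMean_of_card (c := (j * s : ℕ)) hjt fun I hI => by rw [hI]]
    push_cast
    field_simp

/-- The symmetric solution is feasible as soon as `n / t` is large enough. Only the set `∅` has a
negative coefficient in the knapsack matrix; Jensen's inequality on the layers reduces the matter to
`polynomial_knapsack_inequality`. -/
theorem knapsackSolution_mem_SoS {P ε : ℝ} {t n s : ℕ} (hn : n = t * s) (ht : 1 ≤ t)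
    (hP0 : 0 < P) (hP1 : P < 1) (hε0 : 0 < ε) (hε1 : ε ≤ 1) (hL : 4 ≤ ⌊Real.log n⌋₊)
    (hs : 8 * (t : ℝ) ^ (t + 1) * ⌊Real.log n⌋₊ ≤ ε * s) :
    knapsackSolution P ε t n ∈ SoS t (knapsackLP n P) := by
  have hL' : (4 : ℝ) ≤ ⌊Real.log n⌋₊ := by exact_mod_cast hL
  have ht' : (1 : ℝ) ≤ t := by exact_mod_cast ht
  have htt : (t : ℝ) ≤ (t : ℝ) ^ (t + 1) := le_self_pow₀ ht' (by omega)
  have hεs : ε * s ≤ s := mul_le_of_le_one_left (by positivity) hε1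
  have hsL : 8 * (⌊Real.log n⌋₊ : ℝ) ≤ s := by nlinarith
  have hst : (t : ℝ) ≤ s := by nlinarith
  have hs0 : (0 : ℝ) < s := by linarith
  have hLs : ⌊Real.log n⌋₊ < s := by
    have : 8 * ⌊Real.log n⌋₊ ≤ s := by exact_mod_cast hsL
    omega
  have hL1 : 1 ≤ ⌊Real.log n⌋₊ := by omega
  have hsn : s ≤ n := by rw [hn]; exact Nat.le_mul_of_pos_left s ht
  have hsum0 : 0 ≤ ∑ j ∈ Finset.Icc 1 t, ε / (j * s : ℝ) :=
    Finset.sum_nonneg fun _ _ => by positivity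
  have hsum1 : ∑ j ∈ Finset.Icc 1 t, ε / (j * s : ℝ) ≤ 1 / 2 := by
    have hterm : ∀ j ∈ Finset.Icc 1 t, ε / (j * s : ℝ) ≤ 1 / (2 * t) := by
      intro j hj
      have hj1 : (1 : ℝ) ≤ j := by exact_mod_cast (Finset.mem_Icc.1 hj).1
      rw [div_le_div_iff₀ (by positivity) (by positivity)]
      have h1 : 2 * (t : ℝ) ≤ s := by nlinarith
      have h2 : (s : ℝ) ≤ j * s := le_mul_of_one_le_left hs0.le hj1
      nlinarith
    refine (Finset.sum_le_sum hterm).trans (le_of_eq ?_)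
    rw [Finset.sum_const, Nat.card_Icc, nsmul_eq_mul, Nat.add_sub_cancel]
    field_simp
  have hA : (1 + ε) * P / (⌊Real.log n⌋₊ : ℝ) ≤ 1 / 2 := by
    rw [div_le_div_iff₀ (by linarith) two_pos]; nlinarith
  have hy := knapsackSolution_empty (P := P) (ε := ε) hn ht hL1 hLs
  have hy0 : 0 ≤ knapsackSolution P ε t n ∅ := by rw [hy]; linarith
  have hy1 : knapsackSolution P ε t n ∅ ≤ 1 - P / ⌊Real.log n⌋₊ := by
    have : P / (⌊Real.log n⌋₊ : ℝ) ≤ (1 + ε) * P / (⌊Real.log n⌋₊ : ℝ) := by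
      gcongr; nlinarith
    rw [hy]; linarith
  have hpos : ∀ I, 0 ≤ knapsackSolution P ε t n I := by
    intro I
    by_cases hI : I = ∅
    · exact hI ▸ hy0
    · rw [knapsackSolution, if_neg hI]
      exact mul_nonneg (by positivity) (layerWeight_nonneg hP0.le hε0.le _)
  refine ⟨sum_knapsackSolution_eq_one, posSemidef_zetaMatrix_of_nonneg hpos, ?_⟩
  rintro (_ | j | j)
  · rw [posSemidef_zetaMatrix_iff]
    intro v
    have hQ := polynomial_knapsack_inequality hP0 hP1 hL1 ht hε0 hε1 hs hy1
      (natDegree_layerPolynomial_le v)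
    simp only [knapsackLP_eval_zeroOnePoint]
    have hre : ∀ I : Finset (Fin n), ((I.card : ℝ) - P) * knapsackSolution P ε t n I *
        zetaPairing v I ^ 2 = knapsackSolution P ε t n I *
          (((I.card : ℝ) - P) * zetaPairing v I ^ 2) := fun I => by ring
    simp only [hre]
    have hlayer : ∀ k, 1 ≤ k → k ≤ n → ((k : ℝ) - P) * (layerPolynomial v).eval (k : ℝ) ^ 2 ≤
        layerMean n k fun I => ((I.card : ℝ) - P) * zetaPairing v I ^ 2 := by
      intro k hk hkn
      have hk' : (1 : ℝ) ≤ k := by exact_mod_cast hk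
      rw [layerMean_mul_of_card (c := (k : ℝ) - P) fun I hI => by rw [hI],
        ← layerMean_zetaPairing hkn]
      exact mul_le_mul_of_nonneg_left (sq_layerMean_le _) (by linarith)
    rw [sum_knapsackSolution hn ht hL1 hLs, zetaPairing_empty, Finset.card_empty, Nat.cast_zero]
    have h1 := mul_le_mul_of_nonneg_left (hlayer ⌊Real.log n⌋₊ hL1 (by omega))
      (by positivity : 0 ≤ (1 + ε) * P / (⌊Real.log n⌋₊ : ℝ))
    have h2 : ∑ j ∈ Finset.Icc 1 t,
        ε / (j * s : ℝ) * ((j * s - P) * (layerPolynomial v).eval (j * s : ℝ) ^ 2) ≤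
        ∑ j ∈ Finset.Icc 1 t, ε / (j * s : ℝ) *
          layerMean n (j * s) fun I => ((I.card : ℝ) - P) * zetaPairing v I ^ 2 := by
      refine Finset.sum_le_sum fun j hj => mul_le_mul_of_nonneg_left ?_ (by positivity)
      have hj1 := (Finset.mem_Icc.1 hj).1
      have := hlayer (j * s) (Nat.mul_pos hj1 (by omega))
        (by rw [hn]; exact Nat.mul_le_mul_right s (Finset.mem_Icc.1 hj).2)
      push_cast at this
      exact this
    linarith
  · refine posSemidef_zetaMatrix_of_nonneg fun I => mul_nonneg ?_ (hpos I)
    by_cases hj : j ∈ I <;> simp [knapsackLP, LinConstraint.eval, zeroOnePoint, Pi.single_apply, hj]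
  · refine posSemidef_zetaMatrix_of_nonneg fun I => mul_nonneg ?_ (hpos I)
    by_cases hj : j ∈ I <;> simp [knapsackLP, LinConstraint.eval, zeroOnePoint, Pi.single_apply, hj]

/-! ### Integral points, optimal values and the Lasserre rank -/

theorem integralPoints_knapsackLP_cost {n : ℕ} {P : ℝ} (hP0 : 0 < P) {x : Fin n → ℝ}
    (hx : x ∈ integralPoints (knapsackLP n P)) : 1 ≤ knapsackCost n x := by
  obtain ⟨⟨I, rfl⟩, h⟩ := hx
  have h0 := h (.inl ())
  rw [knapsackLP_eval_zeroOnePoint] at h0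
  rw [knapsackCost_zeroOnePoint]
  have : (0 : ℝ) < I.card := by linarith
  exact_mod_cast this

theorem zeroOnePoint_mem_integralPoints {n : ℕ} {P : ℝ} (I : Finset (Fin n)) (hI : P ≤ I.card) :
    zeroOnePoint I ∈ integralPoints (knapsackLP n P) := by
  refine ⟨⟨I, rfl⟩, ?_⟩
  rintro (_ | j | j)
  · rw [knapsackLP_eval_zeroOnePoint]; linarith
  · by_cases hj : j ∈ I <;> simp [knapsackLP, LinConstraint.eval, zeroOnePoint, Pi.single_apply, hj]
  · by_cases hj : j ∈ I <;> simp [knapsackLP, LinConstraint.eval, zeroOnePoint, Pi.single_apply, hj]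

theorem intOpt_knapsack {n : ℕ} {P : ℝ} (hn : 1 ≤ n) (hP0 : 0 < P) (hP1 : P ≤ 1) :
    intOpt (knapsackCost n) (knapsackLP n P) = 1 := by
  refine IsLeast.csInf_eq ⟨⟨zeroOnePoint {⟨0, hn⟩}, ?_, ?_⟩, ?_⟩
  · exact zeroOnePoint_mem_integralPoints _ (by simpa using hP1)
  · simp [knapsackCost_zeroOnePoint]
  · rintro _ ⟨x, hx, rfl⟩
    exact integralPoints_knapsackLP_cost hP0 hx

theorem one_le_cost_of_mem_convexHull {n : ℕ} {P : ℝ} (hP0 : 0 < P) {x : Fin n → ℝ}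
    (hx : x ∈ convexHull ℝ (integralPoints (knapsackLP n P))) : 1 ≤ knapsackCost n x := by
  have hlin : IsLinearMap ℝ (knapsackCost n) :=
    ⟨fun x y => by simp [knapsackCost, Finset.sum_add_distrib],
      fun c x => by simp [knapsackCost, Finset.mul_sum]⟩
  exact convexHull_min (fun y hy => integralPoints_knapsackLP_cost hP0 hy)
    (convex_halfSpace_ge hlin 1) hx

/-- The `(∅, ∅)` entry of the knapsack matrix gives the bound `P` of the linear program. -/
theorem le_objValue_of_mem_SoS {n t : ℕ} {P : ℝ} {y : Finset (Fin n) → ℝ}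
    (hy : y ∈ SoS t (knapsackLP n P)) : P ≤ objValue (knapsackCost n) y := by
  have h := (hy.2.2 (.inl ())).diag_nonneg (i := ⟨∅, by simp⟩)
  have hsum := hy.1
  simp only [zetaMatrix, Matrix.sum_apply, Matrix.smul_apply, Matrix.vecMulVec_apply, zetaVec,
    knapsackLP_eval_zeroOnePoint, Finset.empty_subset, if_true, mul_one, smul_eq_mul, sub_mul,
    Finset.sum_sub_distrib, ← Finset.mul_sum, hsum] at h
  simp only [objValue, knapsackCost_zeroOnePoint]
  linarith

theorem knapsackCost_projection {n : ℕ} (y : Finset (Fin n) → ℝ) :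
    knapsackCost n (fun i => objValue (fun x => x i) y) = objValue (knapsackCost n) y := by
  simp only [knapsackCost, objValue, Finset.sum_mul]
  exact Finset.sum_comm

theorem sosOpt_knapsack_mem_Icc {n t : ℕ} {P : ℝ} {y : Finset (Fin n) → ℝ}
    (hy : y ∈ SoS t (knapsackLP n P)) :
    sosOpt t (knapsackCost n) (knapsackLP n P) ∈ Set.Icc P (objValue (knapsackCost n) y) := by
  have hb : ∀ z ∈ objValue (knapsackCost n) '' SoS t (knapsackLP n P), P ≤ z := by
    rintro _ ⟨z, hz, rfl⟩
    exact le_objValue_of_mem_SoS hz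
  exact ⟨le_csInf ⟨_, y, hy, rfl⟩ hb, csInf_le ⟨P, hb⟩ ⟨y, hy, rfl⟩⟩

/-- A feasible point of value below `1` separates the relaxation from the integral hull, in all
rounds up to `t`. -/
theorem lt_lasserreRank_knapsack {n t : ℕ} {P : ℝ} (hP0 : 0 < P) {y : Finset (Fin n) → ℝ}
    (hy : y ∈ SoS t (knapsackLP n P)) (hval : objValue (knapsackCost n) y < 1) :
    (t : ℕ∞) < lasserreRank (knapsackLP n P) := by
  -- the rank is an infimum, so the strict bound comes from the bound `t + 1` on each round
  refine lt_of_lt_of_le (b := ((t + 1 : ℕ) : ℕ∞)) (by exact_mod_cast Nat.lt_succ_self t) ?_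
  refine le_iInf₂ fun s hs => ?_
  rw [Nat.cast_le]
  by_contra hst
  have hmem : (fun i => objValue (fun x => x i) y) ∈ sosProjection s (knapsackLP n P) :=
    ⟨y, SoS_anti _ (by omega) hy, rfl⟩
  rw [hs] at hmem
  have := one_le_cost_of_mem_convexHull hP0 hmem
  rw [knapsackCost_projection] at this
  linarith

/-! ### Asymptotics of the parameters -/

theorem tendsto_log_natCast : Tendsto (fun m : ℕ => Real.log m) atTop atTop :=
  Real.tendsto_log_atTop.comp tendsto_natCast_atTop_atTop

theorem one_le_rounds {δ : ℝ} {m : ℕ} (hδ1 : δ ≤ 1) (hm : 1 ≤ Real.log m) : 1 ≤ rounds δ m :=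
  Nat.le_floor (by simpa using Real.one_le_rpow hm (by linarith))

theorem rounds_le_rpow {δ : ℝ} {m : ℕ} (hm : 0 ≤ Real.log m) :
    (rounds δ m : ℝ) ≤ Real.log m ^ (1 - δ) :=
  Nat.floor_le (Real.rpow_nonneg hm _)

theorem rounds_le_log {δ : ℝ} {m : ℕ} (hδ0 : 0 ≤ δ) (hm : 1 ≤ Real.log m) :
    (rounds δ m : ℝ) ≤ Real.log m := by
  refine (rounds_le_rpow (by linarith)).trans ?_
  calc Real.log m ^ (1 - δ) ≤ Real.log m ^ (1 : ℝ) :=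
        Real.rpow_le_rpow_of_exponent_le hm (by linarith)
    _ = _ := Real.rpow_one _

/-- The perturbation `ε = (n' + 1)^{-1/2}`; the shift makes it positive for all `n'`. -/
noncomputable def perturbation (m : ℕ) : ℝ := (√((m : ℝ) + 1))⁻¹

theorem perturbation_pos (m : ℕ) : 0 < perturbation m := by
  unfold perturbation; positivity

theorem perturbation_le_one (m : ℕ) : perturbation m ≤ 1 :=
  inv_le_one_of_one_le₀ (Real.one_le_sqrt.2 (by linarith [Nat.cast_nonneg (α := ℝ) m]))

theorem tendsto_rounds_mul_perturbation {δ : ℝ} (hδ0 : 0 < δ) :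
    Tendsto (fun m => (rounds δ m : ℝ) * perturbation m) atTop (𝓝 0) := by
  have h1 : Tendsto (fun m : ℕ => Real.log m / (m : ℝ) ^ (1 / 2 : ℝ)) atTop (𝓝 0) :=
    ((isLittleO_log_rpow_atTop (by norm_num : (0 : ℝ) < 1 / 2)).tendsto_div_nhds_zero).comp
      tendsto_natCast_atTop_atTop
  refine tendsto_of_tendsto_of_tendsto_of_le_of_le' tendsto_const_nhds h1
    (Eventually.of_forall fun m => mul_nonneg (Nat.cast_nonneg _) (perturbation_pos m).le) ?_
  filter_upwards [tendsto_log_natCast.eventually_ge_atTop 1, eventually_ge_atTop 1] with m hm hm1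
  have hm1' : (1 : ℝ) ≤ m := by exact_mod_cast hm1
  rw [div_eq_mul_inv, ← Real.sqrt_eq_rpow]
  refine mul_le_mul (rounds_le_log hδ0.le hm) ?_ (perturbation_pos m).le (by linarith)
  exact inv_anti₀ (Real.sqrt_pos.2 (by linarith)) (Real.sqrt_le_sqrt (by linarith))

/-- The number of rounds is small enough that `t ^ t` is a subpolynomial function of `n'`: its
logarithm is at most `log^{1-δ} n' · log log n'`. -/
theorem eventually_rounds_pow_le {δ : ℝ} (hδ0 : 0 < δ) (hδ1 : δ ≤ 1) :
    ∀ᶠ m : ℕ in atTop, 32 * (rounds δ m : ℝ) ^ (rounds δ m + 2) * Real.log m ≤ √m := by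
  have hlog : ∀ᶠ u : ℝ in atTop, Real.log u ≤ 1 / 16 * u ^ δ := by
    filter_upwards [(isLittleO_log_rpow_atTop hδ0).bound (by norm_num : (0 : ℝ) < 1 / 16),
      eventually_ge_atTop 1] with u hu hu1
    rwa [Real.norm_of_nonneg (Real.log_nonneg hu1),
      Real.norm_of_nonneg (Real.rpow_nonneg (by linarith) _)] at hu
  filter_upwards [tendsto_log_natCast.eventually hlog,
    tendsto_log_natCast.eventually_ge_atTop 1, eventually_ge_atTop 1,
    tendsto_log_natCast.eventually_ge_atTop (16 * Real.log 32)] with m hm hm1 hm2 hm3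
  have hm2' : (1 : ℝ) ≤ m := by exact_mod_cast hm2
  set u := Real.log m with hu
  have hu0 : 0 < u := by linarith
  have ht : (1 : ℝ) ≤ rounds δ m := by exact_mod_cast one_le_rounds hδ1 hm1
  have hlogu : 0 ≤ Real.log u := Real.log_nonneg hm1
  have hlt : Real.log (rounds δ m) ≤ Real.log u :=
    Real.log_le_log (by linarith) (rounds_le_log hδ0.le hm1)
  have h1 : (rounds δ m : ℝ) ≤ u ^ (1 - δ) := rounds_le_rpow hu0.le
  have h2 : u ^ (1 - δ) * u ^ δ = u := by rw [← Real.rpow_add hu0]; simp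
  have h3 : u ^ δ ≤ u := by
    calc u ^ δ ≤ u ^ (1 : ℝ) := Real.rpow_le_rpow_of_exponent_le hm1 hδ1
      _ = u := Real.rpow_one _
  have h4 : (rounds δ m : ℝ) * Real.log u ≤ u / 16 := by
    calc _ ≤ u ^ (1 - δ) * (1 / 16 * u ^ δ) :=
          mul_le_mul h1 hm hlogu (Real.rpow_nonneg hu0.le _)
      _ = (u ^ (1 - δ) * u ^ δ) / 16 := by ring
      _ = u / 16 := by rw [h2]
  have htot : Real.log (32 * (rounds δ m : ℝ) ^ (rounds δ m + 2) * u) ≤ Real.log (√m) := by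
    rw [Real.log_sqrt (by linarith), Real.log_mul (by positivity) hu0.ne',
      Real.log_mul (by norm_num) (by positivity), Real.log_pow]
    have h5 : ((rounds δ m + 2 : ℕ) : ℝ) * Real.log (rounds δ m) ≤
        (rounds δ m + 2) * Real.log u := by
      push_cast
      gcongr
    have h6 : (rounds δ m + 2) * Real.log u ≤ 3 * (u / 16) := by
      nlinarith
    linarith
  exact (Real.log_le_log_iff (by positivity) (Real.sqrt_pos.2 (by linarith))).1 htot

/-- The numerical condition under which the symmetric solution is feasible holds eventually. -/
theorem eventually_feasibility_condition {δ : ℝ} (hδ0 : 0 < δ) (hδ1 : δ ≤ 1) :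
    ∀ᶠ m : ℕ in atTop, 1 ≤ rounds δ m ∧ 4 ≤ ⌊Real.log (items δ m)⌋₊ ∧
      8 * (rounds δ m : ℝ) ^ (rounds δ m + 1) * ⌊Real.log (items δ m)⌋₊ ≤
        perturbation m * (m / rounds δ m : ℕ) := by
  filter_upwards [eventually_rounds_pow_le hδ0 hδ1, tendsto_log_natCast.eventually_ge_atTop 5,
    eventually_ge_atTop 1] with m hm hm1 hm2
  have hm2' : (1 : ℝ) ≤ m := by exact_mod_cast hm2
  have ht : 1 ≤ rounds δ m := one_le_rounds hδ1 (by linarith)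
  obtain ⟨t, htdef⟩ : ∃ t, t = rounds δ m := ⟨_, rfl⟩
  simp only [items]
  rw [← htdef] at ht hm ⊢
  have ht' : (1 : ℝ) ≤ t := by exact_mod_cast ht
  have hpow : (1 : ℝ) ≤ (t : ℝ) ^ (t + 1) := one_le_pow₀ ht'
  have hsqrt : √(m : ℝ) * √m = m := Real.mul_self_sqrt (by linarith)
  have hsqrt1 : 1 ≤ √(m : ℝ) := Real.one_le_sqrt.2 hm2'
  rw [show t + 2 = t + 1 + 1 by rfl, pow_succ] at hm
  have htm : 2 * (t : ℝ) ≤ m := by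
    have h1 : (t : ℝ) ≤ t ^ (t + 1) * t := le_mul_of_one_le_left (by linarith) hpow
    have h2 : 32 * ((t : ℝ) ^ (t + 1) * t) ≤ 32 * (t ^ (t + 1) * t) * Real.log m :=
      le_mul_of_one_le_right (by positivity) (by linarith)
    have h3 : √(m : ℝ) ≤ √m * √m := le_mul_of_one_le_left (by linarith) hsqrt1
    linarith
  -- the number of blocks is at least `m / (2 t)`, and the number of items at least `m / 2`
  have hdiv : (m : ℝ) < t * (m / t : ℕ) + t := by
    exact_mod_cast Nat.lt_mul_div_succ m ht
  have hs : (m : ℝ) ≤ 2 * t * (m / t : ℕ) := by linarith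
  have hnm : ((m / t * t : ℕ) : ℝ) ≤ m := by exact_mod_cast Nat.div_mul_le_self m t
  have hn2 : (m : ℝ) / 2 ≤ ((m / t * t : ℕ) : ℝ) := by push_cast; linarith
  have hlogn : Real.log ((m / t * t : ℕ) : ℝ) ≤ Real.log m := Real.log_le_log (by linarith) hnm
  have hlogn2 : 4 ≤ Real.log ((m / t * t : ℕ) : ℝ) := by
    refine le_trans ?_ (Real.log_le_log (by linarith) hn2)
    rw [Real.log_div (by linarith) (by norm_num)]
    linarith [Real.log_two_lt_d9]
  refine ⟨ht, Nat.le_floor hlogn2, ?_⟩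
  have hfl : (⌊Real.log ((m / t * t : ℕ) : ℝ)⌋₊ : ℝ) ≤ Real.log m :=
    (Nat.floor_le (by linarith)).trans hlogn
  have hε : 1 / 2 ≤ perturbation m * √m := by
    rw [perturbation, inv_mul_eq_div, div_le_div_iff₀ two_pos (by positivity), one_mul]
    rw [Real.sqrt_le_left (by positivity), mul_pow, Real.sq_sqrt (by linarith)]
    linarith
  have hε0 := perturbation_pos m
  have hbase : 8 * (t : ℝ) ^ (t + 1) * ⌊Real.log ((m / t * t : ℕ) : ℝ)⌋₊ ≤
      8 * (t : ℝ) ^ (t + 1) * Real.log m := by gcongr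
  refine hbase.trans (le_of_mul_le_mul_right ?_ (by linarith : (0 : ℝ) < 4 * t))
  calc 8 * (t : ℝ) ^ (t + 1) * Real.log m * (4 * t)
      = 32 * ((t : ℝ) ^ (t + 1) * t) * Real.log m := by ring
    _ ≤ √m := hm
    _ ≤ 2 * (perturbation m * √m) * √m := le_mul_of_one_le_left (by positivity) (by linarith)
    _ = 2 * perturbation m * (√m * √m) := by ring
    _ = 2 * perturbation m * m := by rw [hsqrt]
    _ ≤ 2 * perturbation m * (2 * t * (m / t : ℕ)) := by gcongr
    _ = perturbation m * (m / t : ℕ) * (4 * t) := by ring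

theorem theorem4 (P δ : ℝ) (hP0 : 0 < P) (hP1 : P < 1) (hδ0 : 0 < δ) (hδ1 : δ ≤ 1) :
    ∃ ε : ℕ → ℝ, (∀ m, 0 < ε m) ∧
      (ε =o[atTop] fun m => ((rounds δ m : ℝ))⁻¹) ∧
      (∀ᶠ m in atTop,
        knapsackSolution P (ε m) (rounds δ m) (items δ m) ∈
          SoS (rounds δ m) (knapsackLP (items δ m) P)) ∧
      Tendsto (fun m =>
        objValue (knapsackCost (items δ m))
            (knapsackSolution P (ε m) (rounds δ m) (items δ m)) /
          intOpt (knapsackCost (items δ m)) (knapsackLP (items δ m) P)) atTop (𝓝 P) ∧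
      Tendsto (fun m =>
        sosOpt (rounds δ m) (knapsackCost (items δ m)) (knapsackLP (items δ m) P) /
          intOpt (knapsackCost (items δ m)) (knapsackLP (items δ m) P)) atTop (𝓝 P) ∧
      ∀ᶠ m in atTop, (rounds δ m : ℕ∞) < lasserreRank (knapsackLP (items δ m) P) := by
  have hcond := eventually_feasibility_condition hδ0 hδ1
  have htε := tendsto_rounds_mul_perturbation hδ0
  have hfacts : ∀ᶠ m : ℕ in atTop,
      knapsackSolution P (perturbation m) (rounds δ m) (items δ m) ∈
        SoS (rounds δ m) (knapsackLP (items δ m) P) ∧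
      objValue (knapsackCost (items δ m))
        (knapsackSolution P (perturbation m) (rounds δ m) (items δ m)) =
          (1 + perturbation m) * P + rounds δ m * perturbation m ∧
      intOpt (knapsackCost (items δ m)) (knapsackLP (items δ m) P) = 1 := by
    filter_upwards [hcond] with m hm
    obtain ⟨ht, hL, hs⟩ := hm
    have hn : items δ m = rounds δ m * (m / rounds δ m) := mul_comm _ _
    have hL' : (1 : ℝ) ≤ ⌊Real.log (items δ m)⌋₊ := by exact_mod_cast (by omega)
    have hpow : (1 : ℝ) ≤ (rounds δ m : ℝ) ^ (rounds δ m + 1) :=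
      one_le_pow₀ (by exact_mod_cast ht)
    have hLs : ⌊Real.log (items δ m)⌋₊ < m / rounds δ m := by
      have h1 : perturbation m * ((m / rounds δ m : ℕ) : ℝ) ≤ ((m / rounds δ m : ℕ) : ℝ) :=
        mul_le_of_le_one_left (Nat.cast_nonneg _) (perturbation_le_one m)
      have h2 : (⌊Real.log (items δ m)⌋₊ : ℝ) < ((m / rounds δ m : ℕ) : ℝ) := by nlinarith
      exact_mod_cast h2
    have hn1 : 1 ≤ items δ m := by
      rw [hn]; exact Nat.mul_pos ht (by omega)
    exact ⟨knapsackSolution_mem_SoS hn ht hP0 hP1 (perturbation_pos m) (perturbation_le_one m) hL hs,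
      objValue_knapsackSolution hn ht (by omega) hLs, intOpt_knapsack hn1 hP0 hP1.le⟩
  have hε : Tendsto perturbation atTop (𝓝 0) := by
    refine tendsto_of_tendsto_of_tendsto_of_le_of_le' tendsto_const_nhds htε
      (Eventually.of_forall fun m => (perturbation_pos m).le) ?_
    filter_upwards [hcond] with m hm
    exact le_mul_of_one_le_left (perturbation_pos m).le (by exact_mod_cast hm.1)
  have hval : Tendsto (fun m => (1 + perturbation m) * P + rounds δ m * perturbation m) atTop
      (𝓝 P) := by
    simpa using ((hε.const_add 1).mul_const P).add htε
  refine ⟨perturbation, perturbation_pos, ?_, hfacts.mono fun m hm => hm.1, ?_, ?_, ?_⟩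
  · rw [isLittleO_iff_tendsto']
    · simpa only [div_inv_eq_mul, mul_comm] using htε
    · filter_upwards [hcond] with m hm h0
      have h1 := hm.1
      rw [inv_eq_zero, Nat.cast_eq_zero] at h0
      omega
  · refine hval.congr' ?_
    filter_upwards [hfacts] with m hm
    rw [hm.2.1, hm.2.2, div_one]
  · refine tendsto_of_tendsto_of_tendsto_of_le_of_le' tendsto_const_nhds hval ?_ ?_
    · filter_upwards [hfacts] with m hm
      rw [hm.2.2, div_one]
      exact (sosOpt_knapsack_mem_Icc hm.1).1
    · filter_upwards [hfacts] with m hm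
      rw [hm.2.2, div_one, ← hm.2.1]
      exact (sosOpt_knapsack_mem_Icc hm.1).2
  · filter_upwards [hfacts, hval.eventually_lt_const hP1] with m hm hlt
    exact lt_lasserreRank_knapsack hP0 hm.1 (hm.2.1.trans_lt hlt)
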